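/- A (finite, non-degenerate) cycle set is a finite set $X$ with a binary operation $\cdot$ such that $(x\cdot y)\cdot(x\cdot z)=(y\cdot x)\cdot(y\cdot z)$ for all $x,y,z\in X$, each map $\sigma_x:y\mapsto x\cdot y$ is bijective, and the map $x\mapsto x\cdot x$ is bijective. It is indecomposable if $X$ is not the disjoint union of two non-empty subsets that are both closed under $\cdot$. It is retractable if $\sigma_x=\sigma_y$ for some $x\neq y$. Its retraction $\mathrm{Ret}(X)$ is the quotient of $X$ by the relation $\sigma_x=\sigma_y$, with operation $[x]\cdot[y]=[x\cdot y]$; and $X$ has finite multipermutation level if $|\mathrm{Ret}^k(X)|=1$ for some $k\ge 0$. Isomorphisms are bijections that preserve the operation. Let $p$ be a prime, and for $b\in\mathbb{Z}_p=\mathbb{Z}/p\mathbb{Z}$ let $\chi_0(b)=1$ if $b=0$ and $\chi_0(b)=0$ otherwise. Let $X$ be a retractable indecomposable cycle set of size $p^2$. Then $X$ has finite multipermutation level and is isomorphic to one of the following cycle sets: (1) $\mathbb{Z}_{p^2}$ with $x\cdot y=y+1$; (2) $\mathbb{Z}_p\times\mathbb{Z}_p$ with $$(a,x)\cdot(b,y)=(b+1,\;y+\chi_0(b)S+\Phi(b-a)),$$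 where $S\in\mathbb{Z}_p$ and $\Phi:\mathbb{Z}_p\to\mathbb{Z}_p$ is a non-constant map with $\Phi(0)=0$. Moreover, two pairs of parameters $(S,\Phi)$ and $(S',\Phi')$ as in (2) define isomorphic cycle sets if and only if there is $\alpha\in\mathbb{Z}_p^*$ with $S'=\alpha S$ and $\Phi'=\alpha\Phi$. -/

import Mathlib

universe u v

/-- A finite non-degenerate cycle set: a finite set with a binary operation `x · y` satisfying
`(x · y) · (x · z) = (y · x) · (y · z)`, all of whose left multiplications `y ↦ x · y` are bijective,
and whose square map `x ↦ x · x` is bijective. -/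
structure CycleSet : Type (u + 1) where
  carrier : Type u
  finite : Finite carrier
  op : carrier → carrier → carrier
  op_op : ∀ x y z, op (op x y) (op x z) = op (op y x) (op y z)
  bijective_op : ∀ x, Function.Bijective (op x)
  bijective_sq : Function.Bijective fun x => op x x

namespace CycleSet

instance : CoeSort CycleSet.{u} (Type u) := ⟨CycleSet.carrier⟩

instance (X : CycleSet.{u}) : Finite X := X.finite

/-- The permutation `σ_x : y ↦ x · y`. -/
noncomputable def sigma (X : CycleSet.{u}) (x : X) : Equiv.Perm X :=
  Equiv.ofBijective (X.op x) (X.bijective_op x)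

@[simp]
theorem sigma_apply (X : CycleSet.{u}) (x y : X) : X.sigma x y = X.op x y := rfl

/-- Isomorphism of cycle sets: there is a bijection compatible with the operations. -/
def Isomorphic (X : CycleSet.{u}) (Y : CycleSet.{v}) : Prop :=
  ∃ f : X ≃ Y, ∀ x y, f (X.op x y) = Y.op (f x) (f y)

/-- `X` is indecomposable if it has no partition into two non-empty subsets which are both closed
under the operation. -/
def Indecomposable (X : CycleSet.{u}) : Prop :=
  ¬ ∃ X₁ X₂ : Set X, X₁.Nonempty ∧ X₂.Nonempty ∧ Disjoint X₁ X₂ ∧ X₁ ∪ X₂ = Set.univ ∧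
    (∀ x ∈ X₁, ∀ y ∈ X₁, X.op x y ∈ X₁) ∧ (∀ x ∈ X₂, ∀ y ∈ X₂, X.op x y ∈ X₂)

/-- `X` is retractable if the map `x ↦ σ_x⁻¹` is not injective. -/
def Retractable (X : CycleSet.{u}) : Prop :=
  ¬ Function.Injective fun x : X => (X.sigma x)⁻¹

/-- The kernel of the map `x ↦ σ_x⁻¹`. -/
noncomputable def retSetoid (X : CycleSet.{u}) : Setoid X :=
  Setoid.ker fun x : X => (X.sigma x)⁻¹

theorem retSetoid_iff (X : CycleSet.{u}) (x y : X) :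
    X.retSetoid x y ↔ X.op x = X.op y := by
  unfold retSetoid
  rw [Setoid.ker_def, inv_inj]
  exact ⟨fun h => funext fun z => congrArg (fun s : Equiv.Perm X => s z) h,
    fun h => Equiv.ext fun z => congrFun h z⟩

theorem retSetoid_op (X : CycleSet.{u}) (x x' : X) (hx : X.retSetoid x x') (y y' : X)
    (hy : X.retSetoid y y') : X.retSetoid (X.op x y) (X.op x' y') := by
  rw [retSetoid_iff] at *
  rw [← hx]
  funext w
  obtain ⟨z, rfl⟩ := (X.bijective_op x).2 w
  rw [X.op_op, X.op_op x y' z, hy]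

/-- The retraction `Ret(X)`: the image of `x ↦ σ_x⁻¹`, realized as the quotient of `X` by the
kernel of that map (so the classes of `x` and `y` agree iff `σ_x = σ_y`), with the operation
`[x] · [y] = [x · y]`. -/
noncomputable def Ret (X : CycleSet.{u}) : CycleSet.{u} where
  carrier := Quotient X.retSetoid
  finite := inferInstance
  op := Quotient.map₂ X.op fun x x' hx y y' hy => X.retSetoid_op x x' hx y y' hy
  op_op := by
    rintro ⟨x⟩ ⟨y⟩ ⟨z⟩
    exact congrArg (Quotient.mk X.retSetoid) (X.op_op x y z)
  bijective_op := by
    rintro ⟨x⟩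
    refine Function.Surjective.bijective_of_finite ?_
    rintro ⟨y⟩
    obtain ⟨z, rfl⟩ := (X.bijective_op x).2 y
    exact ⟨Quotient.mk X.retSetoid z, rfl⟩
  bijective_sq := by
    refine Function.Surjective.bijective_of_finite ?_
    rintro ⟨y⟩
    obtain ⟨z, rfl⟩ := X.bijective_sq.2 y
    exact ⟨Quotient.mk X.retSetoid z, rfl⟩

/-- `X` has finite multipermutation level if some iterated retraction of `X` has exactly one
element. -/
def HasFiniteMultipermutationLevel (X : CycleSet.{u}) : Prop :=
  ∃ k : ℕ, Nat.card (Ret^[k] X) = 1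

/-- The cycle set on `ℤ/n` with `x · y = y + 1`. -/
def cyclic (n : ℕ) [NeZero n] : CycleSet.{0} where
  carrier := ZMod n
  finite := inferInstance
  op _ y := y + 1
  op_op _ _ _ := rfl
  bijective_op _ := (Equiv.addRight (1 : ZMod n)).bijective
  bijective_sq := (Equiv.addRight (1 : ZMod n)).bijective

/-- The indicator function `χ₀` of zero. -/
def chi0 {n : ℕ} (b : ZMod n) : ℤ := if b = 0 then 1 else 0

/-- The cycle set on `ℤ/n × ℤ/n` with
`(a, x) · (b, y) = (b + 1, y + χ₀(b) S + Φ(b - a))`. -/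
def family (n : ℕ) [NeZero n] (S : ZMod n) (Φ : ZMod n → ZMod n) : CycleSet.{0} where
  carrier := ZMod n × ZMod n
  finite := inferInstance
  op s t := (t.1 + 1, t.2 + chi0 t.1 • S + Φ (t.1 - s.1))
  op_op := by
    rintro ⟨a, x⟩ ⟨b, y⟩ ⟨c, z⟩
    simp only [add_sub_add_right_eq_sub, Prod.mk.injEq, true_and]
    abel_nf
  bijective_op := by
    rintro ⟨a, x⟩
    refine Function.Surjective.bijective_of_finite ?_
    rintro ⟨b, y⟩
    refine ⟨(b - 1, y - chi0 (b - 1) • S - Φ (b - 1 - a)), ?_⟩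
    ext
    · simp
    · simp only []
      abel_nf
  bijective_sq := by
    refine Function.Surjective.bijective_of_finite ?_
    rintro ⟨b, y⟩
    refine ⟨(b - 1, y - chi0 (b - 1) • S - Φ 0), ?_⟩
    ext
    · simp
    · simp only []
      abel_nf

end CycleSet

/-!
The permutations `σ_x` of a cycle set `X` extend to a map `act` from multisets over `X` to
permutations of `X`, determined by `act 0 = 1` and `act (v + {x}) = σ_{act v x} * act v`; the cycle
set equation says exactly that this does not depend on the order in which the elements of `v` are
added. The cocycle rule `act (v + w) = act (act v · w) * act v` shows that the image of `act` is the
permutation group `G` of `X`, and that addition of multisets descends to the quotient by the kernel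
of `act`. This quotient is an abelian group `A` with as many elements as `G` (the additive group of
the brace `G`). If `X` is indecomposable, `G` is transitive.

Sets of prime size (`IsTransitive.exists_equiv_zmod_of_prime`). Let `|X| = p`. As `G` is transitive
inside a symmetric group of degree `p`, one has `|A| = |G| = m * p` with `m` coprime to `p`, so
`m • A` has order `p`. The map `x ↦ m • [x]` into it is equivariant, so its fibres have equal size
and it is injective or constant. Injectivity would force some, hence every, `m • [x]` to vanish; so
it is constant, and `[v] = 0` implies `p ∣ |v|`. The stabilizer of a point has order `m`, so
`p ∣ |v|` whenever `act v` fixes a point. Therefore the size of `v` modulo `p` depends only on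
`act v x₀`, which gives a bijection `f : X ≃ ℤ/p` with `f (x · y) = f y + 1`.

Sets of size `p²`. The retraction of a retractable transitive `X` has `1` or `p` elements. In the
first case all `σ_x` coincide with one cycle of length `p²`. In the second case the result for prime
size, applied to the retraction, gives an equivariant map `π : X → ℤ/p`. The kernel `K` of the action
on the retraction is abelian by the cocycle rule (`mul_comm_of_retSetoid`), so it acts on each fibre
of `π` as a group of order `p`. This yields coordinates (`exists_prod_equiv_of_transitive`) in
which `(a, x) · (b, y) = (b + 1, y + c a b)`. The cycle set equation makes
`c (a + 1) (b + 1) - c a b` independent of `a`, and a change of origin in each fibre concentrates the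
diagonal `c b b` at `b = 0` (`exists_normal_form`), which is the stated form.

An isomorphism between two members of the family respects the fibres, permutes them by a
translation, and is affine on each fibre with a slope `α` that does not depend on the fibre. This
gives `Φ' = αΦ`, and summing over all fibres gives `S' = αS`.
-/

/-! ### Multisets, fibres, and functions on `ZMod n` -/

theorem Multiset.induction_add_singleton {α : Type*} {motive : Multiset α → Prop} (zero : motive 0)
    (add : ∀ v x, motive v → motive (v + {x})) (v : Multiset α) : motive v :=
  Multiset.induction zero (fun x v hv => by
    rw [← Multiset.singleton_add, add_comm]
    exact add v x hv) v

/-- If a transitive family of permutations preserves the fibres of `f`, all fibres have the same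
size. -/
theorem card_range_mul_card_fiber {α β : Type*} [Finite α] (f : α → β)
    (h : ∀ x y, ∃ g : Equiv.Perm α, g x = y ∧ ∀ a b, f a = f b → f (g a) = f (g b)) (x₀ : α) :
    Nat.card (Set.range f) * Nat.card {x // f x = f x₀} = Nat.card α := by
  have hle : ∀ x y, Nat.card {z // f z = f x} ≤ Nat.card {z // f z = f y} := by
    intro x y
    obtain ⟨g, hg, hf⟩ := h x y
    refine Nat.card_le_card_of_injective
      (fun z : {z // f z = f x} => (⟨g z, by rw [hf _ _ z.2, hg]⟩ : {z // f z = f y})) ?_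
    intro z w hzw
    exact Subtype.ext (g.injective (congrArg Subtype.val hzw))
  have e : α ≃ Set.range f × {x // f x = f x₀} := by
    refine (Equiv.sigmaFiberEquiv (Set.rangeFactorization f)).symm.trans
      ((Equiv.sigmaCongrRight fun b => ?_).trans (Equiv.sigmaEquivProd _ _))
    refine Classical.choice ((Finite.card_eq).1 ?_)
    obtain ⟨_, y, rfl⟩ := b
    rw [← (hle y x₀).antisymm (hle x₀ y)]
    exact Nat.card_congr (Equiv.subtypeEquivRight fun x => by
      simp [Set.rangeFactorization, Subtype.ext_iff])
  rw [Nat.card_congr e, Nat.card_prod]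

/-- The subgroup `m • A` is killed by `p`, so every prime dividing its order divides `p`; hence its
order is coprime to `m` and divides `p`. -/
theorem card_range_nsmul_dvd {A : Type*} [AddCommGroup A] [Finite A] {m p : ℕ}
    (hA : Nat.card A = m * p) (hm : m.Coprime p) :
    Nat.card (nsmulAddMonoidHom m : A →+ A).range ∣ p := by
  have hdvd := AddSubgroup.card_addSubgroup_dvd_card (nsmulAddMonoidHom m : A →+ A).range
  rw [hA] at hdvd
  refine Nat.Coprime.dvd_of_dvd_mul_left (Nat.coprime_of_dvd ?_) hdvd
  intro q hq hq1 hqm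
  have := Fact.mk hq
  obtain ⟨⟨_, a, rfl⟩, hb⟩ := exists_prime_addOrderOf_dvd_card' q hq1
  have hqp : q ∣ p := by
    rw [← hb, addOrderOf_dvd_iff_nsmul_eq_zero]
    refine Subtype.ext ?_
    change p • m • a = 0
    rw [← mul_nsmul, ← hA, card_nsmul_eq_zero']
  exact hq.not_dvd_one (hm ▸ Nat.dvd_gcd hqm hqp)

/-- A function that changes by `r` under translation by `d` is affine along the multiples of `d`. -/
theorem ZMod.eq_zero_add_mul_of_add {n : ℕ} [NeZero n] {R : Type*} [Ring R] (f : ZMod n → R)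
    (d : ZMod n) (r : R) (h : ∀ b, f (b + d) = f b + r) (k : ℕ) : f (k * d) = f 0 + k * r := by
  induction k with
  | zero => simp
  | succ k ih =>
    rw [Nat.cast_succ, Nat.cast_succ, add_mul, one_mul, h, ih, add_assoc, add_mul, one_mul]

theorem ZMod.eq_zero_add_div_mul_of_add {p : ℕ} [Fact p.Prime] (f : ZMod p → ZMod p) {d r : ZMod p}
    (hd : d ≠ 0) (h : ∀ b, f (b + d) = f b + r) (b : ZMod p) : f b = f 0 + r / d * b := by
  have := ZMod.eq_zero_add_mul_of_add f d r h (b / d).val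
  rw [ZMod.natCast_zmod_val, div_mul_cancel₀ _ hd] at this
  rw [this]
  ring

/-- On a cyclic group, a function with vanishing total is a forward difference. -/
theorem exists_forward_difference_eq {n : ℕ} [NeZero n] {A : Type*} [AddCommGroup A]
    (q : ZMod n → A) (hq : ∑ b, q b = 0) : ∃ f : ZMod n → A, ∀ b, f (b + 1) - f b = q b := by
  have hsum : ∑ i ∈ Finset.range n, q i = 0 := by
    rw [← hq]
    refine Finset.sum_bij' (fun i _ => (i : ZMod n)) (fun b _ => b.val) ?_ ?_ ?_ ?_ ?_
    · simp
    · exact fun b _ => Finset.mem_range.2 b.val_lt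
    · exact fun i hi => ZMod.val_cast_of_lt (Finset.mem_range.1 hi)
    · simp
    · simp
  refine ⟨fun b => ∑ i ∈ Finset.range b.val, q i, fun b => ?_⟩
  have hb : ((b.val + 1 : ℕ) : ZMod n) = b + 1 := by simp
  rw [sub_eq_iff_eq_add']
  have hsucc := Finset.sum_range_succ (fun i : ℕ => q i) b.val
  rw [ZMod.natCast_zmod_val] at hsucc
  rw [← hsucc, ← hb]
  rcases (show b.val + 1 ≤ n from b.val_lt).lt_or_eq with h | h
  · exact congrArg (fun k => ∑ i ∈ Finset.range k, q i) (ZMod.val_cast_of_lt h)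
  · rw [h, hsum]
    simp

/-! ### Transitive permutation groups of degree `p ^ 2` with abelian block kernel -/

/-- Let `G` be transitive on `p ^ 2` points and act on the values of `π` by translations, and let the
subgroup `K` that fixes every fibre be abelian. Then `K` acts on the fibre over `0` through a quotient
of order `p`, which gives this fibre the coordinate `ZMod p`; transporting it to the other fibres by
elements of `G` gives coordinates in which all of `G` acts by translations from fibre to fibre. -/
theorem exists_prod_equiv_of_transitive {α : Type*} [Finite α] {p : ℕ} [Fact p.Prime]
    (hα : Nat.card α = p ^ 2) (G : Subgroup (Equiv.Perm α)) (hG : ∀ x y, ∃ g ∈ G, g x = y)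
    (π : α → ZMod p) (hπ : Function.Surjective π)
    (hδ : ∀ g ∈ G, ∃ d, ∀ x, π (g x) = π x + d)
    (hcomm : ∀ g ∈ G, ∀ h ∈ G, (∀ x, π (g x) = π x) → (∀ x, π (h x) = π x) → g * h = h * g) :
    ∃ P : ZMod p × ZMod p ≃ α, (∀ s, π (P s) = s.1) ∧
      ∀ g ∈ G, ∀ d, (∀ x, π (g x) = π x + d) →
        ∃ c : ZMod p → ZMod p, ∀ b y, g (P (b, y)) = P (b + d, y + c b) := by
  have hpp : p.Prime := Fact.out
  obtain ⟨x₀, hx₀⟩ := hπ 0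
  have hfib : Nat.card {x // π x = π x₀} = p := by
    have := card_range_mul_card_fiber π (fun x y => by
      obtain ⟨g, hg, hxy⟩ := hG x y
      obtain ⟨d, hd⟩ := hδ g hg
      exact ⟨g, hxy, fun a b hab => by rw [hd, hd, hab]⟩) x₀
    rw [hα, hπ.range_eq, Nat.card_congr (Equiv.Set.univ _), Nat.card_zmod, pow_two] at this
    exact Nat.eq_of_mul_eq_mul_left hpp.pos this
  let K : Subgroup (Equiv.Perm α) :=
    { carrier := {g | g ∈ G ∧ ∀ x, π (g x) = π x}
      mul_mem' := fun {g h} hg hh => ⟨G.mul_mem hg.1 hh.1, fun x => (hg.2 _).trans (hh.2 x)⟩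
      one_mem' := ⟨G.one_mem, fun _ => rfl⟩
      inv_mem' := fun {g} hg => ⟨G.inv_mem hg.1, fun x => by
        rw [← hg.2, show g (g⁻¹ x) = x from g.apply_symm_apply x]⟩ }
  have hKcomm : ∀ g h : K, g * h = h * g := fun g h =>
    Subtype.ext (hcomm _ g.2.1 _ h.2.1 g.2.2 h.2.2)
  have horb : MulAction.orbit K x₀ = {x | π x = π x₀} := by
    ext y
    constructor
    · rintro ⟨k, rfl⟩
      exact k.2.2 x₀
    · intro hy
      obtain ⟨g, hg, hxy⟩ := hG x₀ y
      obtain ⟨d, hd⟩ := hδ g hg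
      have hd0 : d = 0 := by
        have := hd x₀
        rw [hxy, show π y = π x₀ from hy] at this
        simpa using this
      exact ⟨⟨g, hg, fun x => by rw [hd, hd0, add_zero]⟩, hxy⟩
  -- `K` is abelian and transitive on the fibre over `0`, so modulo a point stabilizer it has order `p`.
  have hnormal : (MulAction.stabilizer K x₀).Normal :=
    ⟨fun n hn g => by rwa [hKcomm g n, mul_inv_cancel_right]⟩
  have hQ : Nat.card (K ⧸ MulAction.stabilizer K x₀) = p := by
    rw [← Nat.card_congr (MulAction.orbitEquivQuotientStabilizer K x₀), horb]
    exact hfib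
  let e : K ⧸ MulAction.stabilizer K x₀ ≃* Multiplicative (ZMod p) :=
    mulEquivOfPrimeCardEq hQ (Nat.card_zmod p)
  let θ : K →* Multiplicative (ZMod p) := e.toMonoidHom.comp (QuotientGroup.mk' _)
  have hθ : ∀ k k' : K, θ k = θ k' ↔ k.1 x₀ = k'.1 x₀ := by
    intro k k'
    change e _ = e _ ↔ _
    rw [e.injective.eq_iff, QuotientGroup.mk'_apply, QuotientGroup.mk'_apply, QuotientGroup.eq,
      MulAction.mem_stabilizer_iff, mul_smul, inv_smul_eq_iff]
    exact eq_comm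
  have hθs : Function.Surjective θ := e.surjective.comp (QuotientGroup.mk'_surjective _)
  have ht : ∀ b, ∃ g ∈ G, ∀ x, π (g x) = π x + b := by
    intro b
    obtain ⟨y, rfl⟩ := hπ b
    obtain ⟨g, hg, hxy⟩ := hG x₀ y
    obtain ⟨d, hd⟩ := hδ g hg
    have : d = π y := by rw [← hxy, hd, hx₀, zero_add]
    exact ⟨g, hg, this ▸ hd⟩
  choose t htG ht using ht
  choose k hk using fun y : ZMod p => hθs (Multiplicative.ofAdd y)
  let P : ZMod p × ZMod p → α := fun s => t s.1 ((k s.2).1 x₀)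
  have hP : ∀ s, π (P s) = s.1 := fun s => by
    rw [ht, (k s.2).2.2, hx₀, zero_add]
  have hinj : Function.Injective P := by
    intro s s' h
    have h1 : s.1 = s'.1 := by rw [← hP, ← hP, h]
    refine Prod.ext h1 ?_
    have h2 : t s.1 ((k s.2).1 x₀) = t s'.1 ((k s'.2).1 x₀) := h
    rw [← h1] at h2
    have h3 := (hθ _ _).2 ((t s.1).injective h2)
    rwa [hk, hk] at h3
  refine ⟨Equiv.ofBijective P ((Nat.bijective_iff_injective_and_card P).2 ⟨hinj, ?_⟩), hP, ?_⟩
  · rw [Nat.card_prod, Nat.card_zmod, hα, pow_two]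
  intro g hg d hd
  -- Carry the fibre over `b` by `g` and bring it back to the fibre over `0`: the result lies in `K`,
  -- and its class modulo the stabilizer is the translation made by `g` on that fibre.
  have hh : ∀ b, (t (b + d))⁻¹ * g * t b ∈ K := by
    intro b
    refine ⟨G.mul_mem (G.mul_mem (G.inv_mem (htG _)) hg) (htG _), fun x => ?_⟩
    have := ht (b + d) ((t (b + d))⁻¹ (g (t b x)))
    rw [show t (b + d) ((t (b + d))⁻¹ _) = _ from (t (b + d)).apply_symm_apply _, hd, ht,
      add_assoc] at this
    exact (add_right_cancel this).symm
  refine ⟨fun b => (θ ⟨_, hh b⟩).toAdd, fun b y => ?_⟩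
  change g (t b ((k y).1 x₀)) = t (b + d) ((k _).1 x₀)
  have key := (hθ (⟨_, hh b⟩ * k y) (k (y + (θ ⟨_, hh b⟩).toAdd))).1 (by
    rw [map_mul, hk, hk, ofAdd_add, ofAdd_toAdd, mul_comm])
  rw [← key]
  simp

namespace CycleSet

/-! ### The permutation cocycle on multisets -/

variable (X : CycleSet.{u})

/-- Adding two elements in either order gives the same permutation: this is the cycle set equation. -/
instance rightCommutative_sigma :
    RightCommutative fun (g : Equiv.Perm X) (x : X) => X.sigma (g x) * g where
  right_comm g x y := by
    ext z
    exact (X.op_op (g x) (g y) (g z))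

/-- The cocycle extending `x ↦ σ_x` to multisets: elements are added one at a time, and adding `x` to
`v` multiplies `act v` on the left by `σ_{act v x}`. -/
noncomputable def act (v : Multiset X) : Equiv.Perm X :=
  v.foldl (fun g x => X.sigma (g x) * g) 1

@[simp]
theorem act_zero : X.act 0 = 1 := rfl

theorem act_add_singleton (v : Multiset X) (x : X) :
    X.act (v + {x}) = X.sigma (X.act v x) * X.act v := by
  rw [act, act, Multiset.foldl_add]
  rfl

theorem act_singleton (x : X) : X.act {x} = X.sigma x := by
  simpa using X.act_add_singleton 0 x

theorem act_add (v w : Multiset X) : X.act (v + w) = X.act (w.map (X.act v)) * X.act v := by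
  induction w using Multiset.induction_add_singleton with
  | zero => simp
  | add w x hw =>
    rw [← add_assoc, act_add_singleton, hw, Multiset.map_add, Multiset.map_singleton,
      act_add_singleton, mul_assoc, Equiv.Perm.mul_apply]

theorem act_mul_act (v w : Multiset X) :
    X.act w * X.act v = X.act (v + w.map ⇑(X.act v)⁻¹) := by
  rw [act_add, Multiset.map_map]
  simp


theorem exists_act_inv (v : Multiset X) : ∃ w, X.act w = (X.act v)⁻¹ := by
  have hpow : ∀ n : ℕ, ∃ w, X.act w = X.act v ^ n := by
    intro n
    induction n with
    | zero => exact ⟨0, by simp⟩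
    | succ n ih =>
      obtain ⟨w, hw⟩ := ih
      exact ⟨_, by rw [pow_succ, ← hw, act_mul_act]⟩
  obtain ⟨w, hw⟩ := hpow (orderOf (X.act v) - 1)
  refine ⟨w, hw.trans (eq_inv_of_mul_eq_one_left ?_)⟩
  rw [← pow_succ, Nat.sub_add_cancel (orderOf_pos _), pow_orderOf_eq_one]

/-- The permutation group of `X`. The image of `act` contains every `σ_x` and is closed under products
and inverses, so it is the group generated by the `σ_x`. -/
noncomputable def permGroup : Subgroup (Equiv.Perm X) where
  carrier := Set.range X.act
  mul_mem' := by
    rintro _ _ ⟨v, rfl⟩ ⟨w, rfl⟩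
    exact ⟨_, (X.act_mul_act w v).symm⟩
  one_mem' := ⟨0, rfl⟩
  inv_mem' := by
    rintro _ ⟨v, rfl⟩
    exact X.exists_act_inv v

theorem act_mem_permGroup (v : Multiset X) : X.act v ∈ X.permGroup := ⟨v, rfl⟩

theorem sigma_mem_permGroup (x : X) : X.sigma x ∈ X.permGroup := ⟨{x}, X.act_singleton x⟩

/-- The kernel of `act` is invariant under the permutation group. -/
theorem act_map_congr {v w : Multiset X} (h : X.act v = X.act w) (u : Multiset X) :
    X.act (v.map (X.act u)) = X.act (w.map (X.act u)) := by
  rw [← mul_left_inj (X.act u), ← act_add, ← act_add, add_comm u, add_comm u, act_add, act_add, h]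

/-- The kernel of `act` as a congruence on multisets. Its quotient is the additive group of the brace
structure on the permutation group. -/
noncomputable def socleCon : AddCon (Multiset X) where
  toSetoid := Setoid.ker X.act
  add' := by
    intro v v' w w' (hv : X.act v = X.act v') (hw : X.act w = X.act w')
    change X.act (v + w) = X.act (v' + w')
    rw [act_add, hv, ← act_add, add_comm, act_add, hw, ← act_add, add_comm]

theorem socleCon_eq {v w : Multiset X} :
    (v : X.socleCon.Quotient) = w ↔ X.act v = X.act w :=
  X.socleCon.eq

theorem card_socleCon_quotient : Nat.card X.socleCon.Quotient = Nat.card X.permGroup :=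
  Nat.card_congr (Setoid.quotientKerEquivRange X.act)

instance : Finite X.socleCon.Quotient :=
  Finite.of_equiv X.permGroup (Setoid.quotientKerEquivRange X.act).symm

/-- The quotient is a finite cancellative monoid, so translations are surjective. -/
theorem exists_neg_socleCon_quotient (a : X.socleCon.Quotient) : ∃ b, b + a = 0 := by
  refine (Finite.injective_iff_surjective (f := fun b => b + a)).1 ?_ 0
  intro b c h
  induction a using AddCon.induction_on with | _ w
  induction b using AddCon.induction_on with | _ v
  induction c using AddCon.induction_on with | _ v'
  rw [socleCon_eq]
  have h' : X.act (v + w) = X.act (v' + w) := X.socleCon_eq.1 h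
  rw [add_comm v, add_comm v', act_add, act_add, mul_left_inj] at h'
  obtain ⟨u, hu⟩ := X.exists_act_inv w
  simpa [← Multiset.map_map, Multiset.map_map, hu] using X.act_map_congr h' u

noncomputable instance : Neg X.socleCon.Quotient where
  neg a := (X.exists_neg_socleCon_quotient a).choose

noncomputable instance : AddCommGroup X.socleCon.Quotient where
  zsmul := zsmulRec
  neg_add_cancel a := (X.exists_neg_socleCon_quotient a).choose_spec

/-- The permutation group acts transitively. -/
def IsTransitive : Prop := ∀ x y, ∃ v, X.act v x = y

variable {X}

/-- An orbit of the permutation group and its complement are both closed under the operation. -/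
theorem Indecomposable.isTransitive (hX : X.Indecomposable) : X.IsTransitive := by
  intro x y
  by_contra hy
  have hstep : ∀ z w, (∃ v, X.act v x = w) → ∃ v, X.act v x = X.op z w := by
    rintro z _ ⟨v, rfl⟩
    exact ⟨v + {(X.act v)⁻¹ z}, by simp [act_add_singleton]⟩
  have hback : ∀ z w, (∃ v, X.act v x = X.op z w) → ∃ v, X.act v x = w := by
    intro z w hw
    obtain ⟨⟨w', hw'⟩, h⟩ := (Finite.injective_iff_surjective
      (f := fun w : {w // ∃ v, X.act v x = w} =>
        (⟨X.op z w, hstep z w w.2⟩ : {w // ∃ v, X.act v x = w}))).1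
      (fun a b hab => Subtype.ext ((X.bijective_op z).1 (congrArg Subtype.val hab))) ⟨_, hw⟩
    rwa [← (X.bijective_op z).1 (congrArg Subtype.val h)]
  exact hX ⟨{w | ∃ v, X.act v x = w}, {w | ∃ v, X.act v x = w}ᶜ, ⟨x, 0, rfl⟩, ⟨y, hy⟩,
    disjoint_compl_right, Set.union_compl_self _, fun z _ w hw => hstep z w hw,
    fun z _ w hw h => hw (hback z w h)⟩

/-- If the size of `v` is divisible by `|X|` whenever `act v` fixes `x₀`, then sending `act v x₀` to
the size of `v` is a well-defined bijection onto `ZMod n`, and every `σ_x` becomes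
translation by `1`. -/
theorem IsTransitive.exists_equiv_zmod {n : ℕ} [NeZero n] (hX : X.IsTransitive)
    (hn : Nat.card X = n) (x₀ : X) (h : ∀ v, X.act v x₀ = x₀ → n ∣ v.card) :
    ∃ f : X ≃ ZMod n, ∀ x y, f (X.op x y) = f y + 1 := by
  have hwd : ∀ v w, X.act v x₀ = X.act w x₀ → (v.card : ZMod n) = w.card := by
    intro v w hvw
    obtain ⟨u, hu⟩ := X.exists_act_inv w
    have key : ∀ v, X.act v x₀ = X.act w x₀ → (v.card : ZMod n) + u.card = 0 := by
      intro v hv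
      have := h (v + u.map ⇑(X.act v)⁻¹) (by rw [← act_mul_act]; simp [hv, hu])
      rw [← ZMod.natCast_eq_zero_iff] at this
      simpa using this
    exact add_right_cancel ((key v hvw).trans (key w rfl).symm)
  choose c hc using hX x₀
  have hf : ∀ x y, ((c (X.op x y)).card : ZMod n) = (c y).card + 1 := by
    intro x y
    rw [hwd (c (X.op x y)) (c y + {(X.act (c y))⁻¹ x})]
    · simp
    · simp [act_add_singleton, hc]
  have hsurj : Function.Surjective fun y => ((c y).card : ZMod n) := by
    intro i
    have : ∀ k : ℕ, ∃ y, ((c y).card : ZMod n) = (c x₀).card + k := by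
      intro k
      induction k with
      | zero => exact ⟨x₀, by simp⟩
      | succ k ih =>
        obtain ⟨y, hy⟩ := ih
        exact ⟨X.op y y, by rw [hf, hy]; push_cast; ring⟩
    obtain ⟨y, hy⟩ := this (i - (c x₀).card).val
    exact ⟨y, by simpa using hy⟩
  refine ⟨Equiv.ofBijective _ ((Nat.bijective_iff_surjective_and_card _).2 ⟨hsurj, ?_⟩), hf⟩
  rw [hn, Nat.card_zmod]

/-! ### Transitive cycle sets of prime size -/

/-- In prime degree `p` the prime `p` divides the order of the permutation group exactly once. -/
theorem IsTransitive.card_permGroup {p : ℕ} [Fact p.Prime] (hX : X.IsTransitive)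
    (hp : Nat.card X = p) (x₀ : X) :
    Nat.card X.permGroup = Nat.card (MulAction.stabilizer X.permGroup x₀) * p ∧
      (Nat.card (MulAction.stabilizer X.permGroup x₀)).Coprime p := by
  have hpp : p.Prime := Fact.out
  have : MulAction.IsPretransitive X.permGroup X := ⟨fun x y => by
    obtain ⟨v, hv⟩ := hX x y
    exact ⟨⟨_, X.act_mem_permGroup v⟩, hv⟩⟩
  have hcard : Nat.card X.permGroup = Nat.card (MulAction.stabilizer X.permGroup x₀) * p := by
    rw [← hp, ← MulAction.index_stabilizer_of_transitive X.permGroup x₀, Subgroup.card_mul_index]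
  refine ⟨hcard, ?_⟩
  have hdvd : Nat.card X.permGroup ∣ p.factorial := by
    rw [← hp, ← Nat.card_perm]
    exact Subgroup.card_subgroup_dvd_card _
  rw [hcard, ← Nat.mul_factorial_pred hpp.ne_zero, mul_comm] at hdvd
  refine ((hpp.coprime_iff_not_dvd).2 fun h => ?_).symm
  have := (hpp.dvd_factorial).1 (h.trans (Nat.dvd_of_mul_dvd_mul_left hpp.pos hdvd))
  have := hpp.pos
  omega

/-- In prime size `p`, the size of a multiset modulo `p` is well defined on the quotient by the kernel
of `act`. -/
theorem IsTransitive.dvd_card_of_act_eq_one {p : ℕ} [Fact p.Prime] (hX : X.IsTransitive)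
    (hp : Nat.card X = p) {v : Multiset X} (hv : X.act v = 1) : p ∣ v.card := by
  have hpp : p.Prime := Fact.out
  have hXfin : Nonempty X ∧ Nontrivial X := by
    have : 1 < Nat.card X := hp ▸ hpp.one_lt
    have := Finite.one_lt_card_iff_nontrivial.1 this
    exact ⟨inferInstance, this⟩
  obtain ⟨⟨x₀⟩, _⟩ := hXfin
  obtain ⟨hG, hm⟩ := hX.card_permGroup hp x₀
  set m := Nat.card (MulAction.stabilizer X.permGroup x₀)
  have hA := X.card_socleCon_quotient.trans hG
  let u : X → X.socleCon.Quotient := fun x => m • (({x} : Multiset X) : X.socleCon.Quotient)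
  have hu : ∀ x, u x = ((Multiset.replicate m x : Multiset X) : X.socleCon.Quotient) := by
    intro x
    rw [← Multiset.nsmul_singleton]
    rfl
  have hinv : ∀ w a b, u a = u b → u (X.act w a) = u (X.act w b) := by
    intro w a b hab
    rw [hu, hu, socleCon_eq] at hab ⊢
    simpa using X.act_map_congr hab w
  have hzero : ∀ w a, u a = 0 → u (X.act w a) = 0 := by
    intro w a ha
    have h0 : (0 : X.socleCon.Quotient) = ((0 : Multiset X) : X.socleCon.Quotient) := rfl
    rw [hu, h0, socleCon_eq] at ha ⊢
    simpa using X.act_map_congr ha w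
  -- The fibres of `u` have equal size, so `u` takes one value or `p` values.
  have hconst : ∀ x y, u x = u y := by
    have hmul := card_range_mul_card_fiber u (fun x y => by
      obtain ⟨w, hw⟩ := hX x y
      exact ⟨_, hw, hinv w⟩) x₀
    rw [hp] at hmul
    rcases (Nat.dvd_prime hpp).1 (Dvd.intro _ hmul) with h1 | h1
    · intro x y
      have := (Nat.card_eq_one_iff_unique.1 h1).1
      exact congrArg Subtype.val (Subsingleton.elim (⟨u x, x, rfl⟩ : Set.range u) ⟨u y, y, rfl⟩)
    -- If `u` takes `p` values, it is onto `m • A`, so it takes the value `0`.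
    · have hsub : Set.range u ⊆ ((nsmulAddMonoidHom m :
          X.socleCon.Quotient →+ X.socleCon.Quotient).range : Set X.socleCon.Quotient) := by
        rintro _ ⟨x, rfl⟩
        exact ⟨_, rfl⟩
      have heq := Set.eq_of_subset_of_ncard_le hsub (by
        change Nat.card _ ≤ Nat.card (Set.range u)
        rw [h1]
        exact Nat.le_of_dvd hpp.pos (card_range_nsmul_dvd hA hm))
      obtain ⟨y, hy⟩ : (0 : X.socleCon.Quotient) ∈ Set.range u := heq ▸ zero_mem _
      have : ∀ x, u x = 0 := fun x => by
        obtain ⟨w, rfl⟩ := hX y x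
        exact hzero w y hy
      intro x y
      rw [this, this]
  have hsum : ∀ w : Multiset X, m • (w : X.socleCon.Quotient) = w.card • u x₀ := by
    intro w
    induction w using Multiset.induction_add_singleton with
    | zero =>
      rw [Multiset.card_zero, zero_nsmul]
      exact nsmul_zero m
    | add w x hw =>
      rw [Multiset.card_add, add_nsmul, ← hw, Multiset.card_singleton, one_nsmul, hconst x₀ x,
        ← nsmul_add]
      rfl
  have hne : u x₀ ≠ 0 := by
    intro h0
    obtain ⟨a, ha⟩ := exists_prime_addOrderOf_dvd_card' (G := X.socleCon.Quotient) p
      (hA ▸ Dvd.intro_left _ rfl)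
    induction a using AddCon.induction_on with | _ w
    have : p ∣ m := by
      rw [← ha, addOrderOf_dvd_iff_nsmul_eq_zero, hsum, h0, nsmul_zero]
    exact hpp.not_dvd_one (hm ▸ Nat.dvd_gcd this dvd_rfl)
  have hord : addOrderOf (u x₀) = p := by
    refine addOrderOf_eq_prime ?_ hne
    rw [← mul_nsmul, ← hA, card_nsmul_eq_zero']
  rw [← hord, addOrderOf_dvd_iff_nsmul_eq_zero, ← hsum, X.socleCon_eq.2 (hv.trans X.act_zero.symm)]
  exact nsmul_zero m

/-- A transitive cycle set of prime size is cyclic. -/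
theorem IsTransitive.exists_equiv_zmod_of_prime {p : ℕ} [Fact p.Prime] (hX : X.IsTransitive)
    (hp : Nat.card X = p) : ∃ f : X ≃ ZMod p, ∀ x y, f (X.op x y) = f y + 1 := by
  have hpp : p.Prime := Fact.out
  obtain ⟨⟨x₀⟩, -⟩ := Nat.card_pos_iff.1 (hp ▸ hpp.pos : 0 < Nat.card X)
  obtain ⟨-, hm⟩ := hX.card_permGroup hp x₀
  refine hX.exists_equiv_zmod hp x₀ fun v hv => ?_
  have hpow : ∀ n : ℕ, ∃ w : Multiset X, w.card = n * v.card ∧ X.act w = X.act v ^ n := by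
    intro n
    induction n with
    | zero => exact ⟨0, by simp, by simp⟩
    | succ n ih =>
      obtain ⟨w, hw, hw'⟩ := ih
      exact ⟨v + w.map ⇑(X.act v)⁻¹, by rw [Multiset.card_add, Multiset.card_map, hw]; ring,
        by rw [pow_succ, ← hw', act_mul_act]⟩
  obtain ⟨w, hw, hw'⟩ := hpow (Nat.card (MulAction.stabilizer X.permGroup x₀))
  have hone : X.act v ^ Nat.card (MulAction.stabilizer X.permGroup x₀) = 1 :=
    congrArg (fun g : MulAction.stabilizer X.permGroup x₀ => (g.1 : Equiv.Perm X))
      (pow_card_eq_one' (x := (⟨⟨_, X.act_mem_permGroup v⟩, hv⟩ :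
        MulAction.stabilizer X.permGroup x₀)))
  have := hX.dvd_card_of_act_eq_one hp (hw'.trans hone)
  rw [hw] at this
  exact hm.symm.dvd_of_dvd_mul_left this

/-! ### The retraction -/

theorem retSetoid_act {x y : X} (h : X.retSetoid x y) (v : Multiset X) :
    X.retSetoid (X.act v x) (X.act v y) := by
  induction v using Multiset.induction_add_singleton with
  | zero => exact h
  | add v z ih =>
    rw [act_add_singleton]
    exact X.retSetoid_op _ _ (X.retSetoid.refl _) _ _ ih

theorem sigma_congr {x y : X} (h : X.retSetoid x y) : X.sigma x = X.sigma y :=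
  Equiv.ext (congrFun ((X.retSetoid_iff x y).1 h))

/-- `act v` depends only on the classes of the elements of `v` in the retraction. -/
theorem act_map_of_retSetoid {g : X → X} (hg : ∀ x, X.retSetoid (g x) x) (v : Multiset X) :
    X.act (v.map g) = X.act v := by
  induction v using Multiset.induction_add_singleton with
  | zero => rfl
  | add v x ih =>
    rw [Multiset.map_add, Multiset.map_singleton, act_add_singleton, act_add_singleton, ih,
      sigma_congr (retSetoid_act (hg x) v)]

/-- The kernel of the action of the permutation group on the retraction is abelian: for `act v` and
`act w` in it, the cocycle rule reduces to `act (v + w) = act w * act v`, and addition is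
commutative. -/
theorem mul_comm_of_retSetoid {g h : Equiv.Perm X} (hg : g ∈ X.permGroup) (hh : h ∈ X.permGroup)
    (hg' : ∀ x, X.retSetoid (g x) x) (hh' : ∀ x, X.retSetoid (h x) x) : g * h = h * g := by
  obtain ⟨v, rfl⟩ := hg
  obtain ⟨w, rfl⟩ := hh
  rw [← act_map_of_retSetoid hg' w, ← act_add, add_comm, act_add, act_map_of_retSetoid hh']
  rw [act_map_of_retSetoid hg']

/-- The projection of `X` onto its retraction. -/
noncomputable def toRet (x : X) : X.Ret := Quotient.mk X.retSetoid x

theorem toRet_surjective : Function.Surjective (toRet (X := X)) := Quotient.mk_surjective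

theorem toRet_eq_iff {x y : X} : toRet x = toRet y ↔ X.retSetoid x y := Quotient.eq

theorem toRet_act (v : Multiset X) (x : X) :
    toRet (X.act v x) = X.Ret.act (v.map toRet) (toRet x) := by
  induction v using Multiset.induction_add_singleton generalizing x with
  | zero => rfl
  | add v z ih =>
    rw [Multiset.map_add, Multiset.map_singleton, act_add_singleton, act_add_singleton,
      Equiv.Perm.mul_apply, Equiv.Perm.mul_apply, ← ih, ← ih]
    rfl

theorem IsTransitive.ret (hX : X.IsTransitive) : X.Ret.IsTransitive := by
  intro x y
  obtain ⟨x, rfl⟩ := toRet_surjective x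
  obtain ⟨y, rfl⟩ := toRet_surjective y
  obtain ⟨v, rfl⟩ := hX x y
  exact ⟨_, (toRet_act v x).symm⟩

theorem IsTransitive.card_ret_dvd (hX : X.IsTransitive) : Nat.card X.Ret ∣ Nat.card X := by
  rcases isEmpty_or_nonempty X with _ | ⟨⟨x₀⟩⟩
  · simp
  · rw [← card_range_mul_card_fiber toRet (fun x y => by
        obtain ⟨v, hv⟩ := hX x y
        exact ⟨_, hv, fun a b hab => toRet_eq_iff.2 (retSetoid_act (toRet_eq_iff.1 hab) v)⟩) x₀,
      toRet_surjective.range_eq, Nat.card_congr (Equiv.Set.univ _)]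
    exact Dvd.intro _ rfl

theorem Retractable.card_ret_ne (hX : X.Retractable) : Nat.card X.Ret ≠ Nat.card X := by
  intro h
  have hbij : Function.Bijective (toRet (X := X)) :=
    (Nat.bijective_iff_surjective_and_card _).2 ⟨toRet_surjective, h.symm⟩
  exact hX fun x y hxy => hbij.1 (toRet_eq_iff.2 hxy)

theorem card_ret_eq_one_iff [Nonempty X] : Nat.card X.Ret = 1 ↔ ∀ x y, X.op x = X.op y := by
  constructor
  · intro h x y
    have := (Nat.card_eq_one_iff_unique.1 h).1
    exact (X.retSetoid_iff x y).1 (toRet_eq_iff.1 (Subsingleton.elim _ _))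
  · intro h
    rw [Nat.card_eq_one_iff_unique]
    refine ⟨⟨fun x y => ?_⟩, ⟨toRet (Classical.arbitrary X)⟩⟩
    obtain ⟨x, rfl⟩ := toRet_surjective x
    obtain ⟨y, rfl⟩ := toRet_surjective y
    exact toRet_eq_iff.2 ((X.retSetoid_iff x y).2 (h x y))

theorem IsTransitive.isomorphic_cyclic {n : ℕ} [NeZero n] (hX : X.IsTransitive)
    (hn : Nat.card X = n) (h : Nat.card X.Ret = 1) :
    X.Isomorphic (cyclic n) := by
  obtain ⟨⟨x₀⟩, -⟩ := Nat.card_pos_iff.1 (hn ▸ NeZero.pos n : 0 < Nat.card X)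
  have : Nonempty X := ⟨x₀⟩
  have hact : ∀ v, X.act v = X.sigma x₀ ^ v.card := by
    intro v
    induction v using Multiset.induction_add_singleton with
    | zero => rfl
    | add v x ih =>
      rw [act_add_singleton, ih, Multiset.card_add, Multiset.card_singleton, pow_succ',
        sigma_congr ((X.retSetoid_iff _ _).2 (card_ret_eq_one_iff.1 h _ x₀))]
  have := Fintype.ofFinite X
  have hcyc : (X.sigma x₀).IsCycleOn (Finset.univ : Finset X) := by
    refine ⟨by simp, fun x _ y _ => ?_⟩
    obtain ⟨v, hv⟩ := hX x y
    exact ⟨v.card, by rw [zpow_natCast, ← hact, hv]⟩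
  exact hX.exists_equiv_zmod hn x₀ fun v hv => by
    rwa [hact, hcyc.pow_apply_eq (Finset.mem_univ _), Finset.card_univ, ← Nat.card_eq_fintype_card,
      hn] at hv

/-! ### Retractable cycle sets of size `p ^ 2` -/

/-- The normal form of the translation parts `c a b` after a change `f` of origins. With
`S = ∑ b, c b b`, the values `c b b` can be changed by forward differences to `S` at `b = 0` and `0`
elsewhere; and the cycle set equation makes `c a b - c b b` a function of `b - a`. -/
theorem exists_normal_form {n : ℕ} [NeZero n] (c : ZMod n → ZMod n → ZMod n)
    (hc : ∀ a b z, c a z + c (b + 1) (z + 1) = c b z + c (a + 1) (z + 1)) :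
    ∃ (S : ZMod n) (Φ f : ZMod n → ZMod n), Φ 0 = 0 ∧
      ∀ a b, c a b + (f (b + 1) - f b) = chi0 b • S + Φ (b - a) := by
  obtain ⟨f, hf⟩ := exists_forward_difference_eq
    (fun b => chi0 b • (∑ i, c i i) - c b b) (by
      rw [Finset.sum_sub_distrib, ← Finset.sum_smul]
      simp [chi0])
  have hshift : ∀ (k : ℕ) a z, c (a + k) (z + k) - c (z + k) (z + k) = c a z - c z z := by
    intro k a z
    induction k with
    | zero => simp
    | succ k ih =>
      rw [← ih, sub_eq_sub_iff_add_eq_add]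
      have := hc (a + k) (z + k) (z + k)
      push_cast
      rw [← add_assoc, ← add_assoc, add_comm, ← this, add_comm]
  refine ⟨∑ i, c i i, fun i => c 0 i - c i i, f, sub_self _, fun a b => ?_⟩
  have := hshift a.val 0 (b - a)
  simp only [ZMod.natCast_val, ZMod.cast_id', id_eq, zero_add, sub_add_cancel] at this
  rw [hf]
  change _ = _ + (c 0 (b - a) - c (b - a) (b - a))
  rw [← this]
  abel

theorem IsTransitive.isomorphic_family {p : ℕ} [Fact p.Prime] (hX : X.IsTransitive)
    (hp : Nat.card X = p ^ 2) (hret : Nat.card X.Ret = p) :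
    ∃ (S : ZMod p) (Φ : ZMod p → ZMod p), (¬ ∃ c, ∀ i, Φ i = c) ∧ Φ 0 = 0 ∧
      X.Isomorphic (family p S Φ) := by
  have hpp : p.Prime := Fact.out
  obtain ⟨φ, hφ⟩ := hX.ret.exists_equiv_zmod_of_prime hret
  let π : X → ZMod p := fun x => φ (toRet x)
  have hπop : ∀ x y, π (X.op x y) = π y + 1 := fun x y =>
    hφ (toRet x) (Quotient.mk X.retSetoid y)
  have hπ : ∀ x y, π x = π y ↔ X.op x = X.op y := fun x y => by
    rw [← X.retSetoid_iff]
    exact φ.injective.eq_iff.trans toRet_eq_iff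
  have hπact : ∀ v x, π (X.act v x) = π x + v.card := by
    intro v x
    induction v using Multiset.induction_add_singleton with
    | zero => simp
    | add v z ih =>
      rw [act_add_singleton, Equiv.Perm.mul_apply, sigma_apply, hπop, ih, add_assoc,
        Multiset.card_add, Multiset.card_singleton, Nat.cast_add, Nat.cast_one]
  obtain ⟨P, hP, hc⟩ := exists_prod_equiv_of_transitive hp X.permGroup
    (fun x y => by
      obtain ⟨v, hv⟩ := hX x y
      exact ⟨_, X.act_mem_permGroup v, hv⟩) π
    (φ.surjective.comp toRet_surjective)
    (by
      rintro _ ⟨v, rfl⟩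
      exact ⟨_, hπact v⟩)
    (fun g hg h hh hg' hh' => mul_comm_of_retSetoid hg hh
      (fun x => (X.retSetoid_iff _ _).2 ((hπ _ _).1 (hg' x)))
      (fun x => (X.retSetoid_iff _ _).2 ((hπ _ _).1 (hh' x))))
  choose c hc using fun a => hc _ (X.sigma_mem_permGroup (P (a, 0))) 1 (hπop _)
  have hop : ∀ a x b y, X.op (P (a, x)) (P (b, y)) = P (b + 1, y + c a b) := by
    intro a x b y
    rw [(hπ (P (a, x)) (P (a, 0))).1 (by rw [hP, hP])]
    exact hc a b y
  obtain ⟨S, Φ, f, hΦ, hf⟩ := exists_normal_form c fun a b z => by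
    have := X.op_op (P (a, 0)) (P (b, 0)) (P (z, 0))
    simp only [hop, zero_add] at this
    exact congrArg Prod.snd (P.injective this)
  -- Moving the origin of the fibre over `b` by `f b` brings the translation parts to normal form.
  let E : ZMod p × ZMod p ≃ X :=
    (Equiv.prodShear (Equiv.refl _) fun b => Equiv.subRight (f b)).trans P
  have hE : ∀ a x b y, X.op (E (a, x)) (E (b, y)) = E (b + 1, y + chi0 b • S + Φ (b - a)) := by
    intro a x b y
    change X.op (P (a, _)) (P (b, y - f b)) = P (b + 1, y + chi0 b • S + Φ (b - a) - f (b + 1))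
    rw [hop, add_assoc y, ← hf]
    congr 2
    abel
  refine ⟨S, Φ, ?_, hΦ, E.symm, fun s t => ?_⟩
  -- A constant `Φ` is zero, so all `σ_x` coincide and the retraction is trivial.
  · rintro ⟨d, hd⟩
    have hd0 : ∀ i, Φ i = 0 := fun i => by rw [hd, ← hd 0, hΦ]
    have : Nonempty X := ⟨P (0, 0)⟩
    have h1 := (card_ret_eq_one_iff (X := X)).2 fun x y => by
      obtain ⟨⟨a, x⟩, rfl⟩ := E.surjective x
      obtain ⟨⟨a', x'⟩, rfl⟩ := E.surjective y
      funext z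
      obtain ⟨⟨b, y⟩, rfl⟩ := E.surjective z
      rw [hE, hE, hd0, hd0]
    exact hpp.one_lt.ne' (hret.symm.trans h1)
  · obtain ⟨⟨a, x⟩, rfl⟩ := E.surjective s
    obtain ⟨⟨b, y⟩, rfl⟩ := E.surjective t
    rw [hE]
    change E.symm (E _) = (family p S Φ).op (E.symm (E _)) (E.symm (E _))
    simp only [Equiv.symm_apply_apply]
    rfl

theorem IsTransitive.classification {p : ℕ} [Fact p.Prime] (hX : X.IsTransitive)
    (hp : Nat.card X = p ^ 2) (hret : X.Retractable) :
    X.HasFiniteMultipermutationLevel ∧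
      (X.Isomorphic (CycleSet.cyclic (p ^ 2)) ∨
        ∃ (S : ZMod p) (Φ : ZMod p → ZMod p), (¬ ∃ c, ∀ i, Φ i = c) ∧ Φ 0 = 0 ∧
          X.Isomorphic (CycleSet.family p S Φ)) := by
  have hpp : p.Prime := Fact.out
  obtain ⟨⟨x₀⟩, -⟩ := Nat.card_pos_iff.1 (hp ▸ pow_pos hpp.pos 2 : 0 < Nat.card X)
  obtain ⟨k, hk, hk'⟩ := (Nat.dvd_prime_pow hpp).1 (hp ▸ hX.card_ret_dvd)
  have hk2 : k ≠ 2 := by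
    rintro rfl
    exact hret.card_ret_ne (hk'.trans hp.symm)
  obtain rfl | rfl : k = 0 ∨ k = 1 := by omega
  · rw [pow_zero] at hk'
    exact ⟨⟨1, hk'⟩, Or.inl (hX.isomorphic_cyclic hp hk')⟩
  · rw [pow_one] at hk'
    refine ⟨⟨2, ?_⟩, Or.inr (hX.isomorphic_family hp hk')⟩
    obtain ⟨φ, hφ⟩ := hX.ret.exists_equiv_zmod_of_prime hk'
    have : Nonempty X.Ret := ⟨toRet x₀⟩
    exact (card_ret_eq_one_iff (X := X.Ret)).2 fun x y => funext fun z => φ.injective (by rw [hφ, hφ])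

/-! ### Isomorphisms within the family -/

theorem Isomorphic.exists_unit {p : ℕ} [Fact p.Prime] {S S' : ZMod p} {Φ Φ' : ZMod p → ZMod p}
    (hΦ : ¬ ∃ c, ∀ i, Φ i = c) (hΦ0 : Φ 0 = 0) (hΦ' : ¬ ∃ c, ∀ i, Φ' i = c) (hΦ0' : Φ' 0 = 0)
    (hiso : (family p S Φ).Isomorphic (family p S' Φ')) :
    ∃ α : (ZMod p)ˣ, S' = α * S ∧ ∀ i, Φ' i = α * Φ i := by
  obtain ⟨F, hF⟩ := hiso
  change ZMod p × ZMod p ≃ ZMod p × ZMod p at F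
  replace hF : ∀ a x b y, F (b + 1, y + chi0 b • S + Φ (b - a)) =
      ((F (b, y)).1 + 1, (F (b, y)).2 + chi0 (F (b, y)).1 • S' +
        Φ' ((F (b, y)).1 - (F (a, x)).1)) := fun a x b y => hF (a, x) (b, y)
  have hfst : ∀ a x, (F (a, x)).1 = (F (a, 0)).1 := by
    intro a x
    by_contra hne
    refine hΦ' ⟨Φ' 0, fun i => ?_⟩
    -- Otherwise `Φ'` has a nonzero period, so it is constant.
    have hper : ∀ j, Φ' (j + ((F (a, x)).1 - (F (a, 0)).1)) = Φ' j + 0 := by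
      intro j
      obtain ⟨⟨b, y⟩, hb⟩ := F.surjective (j + (F (a, x)).1, 0)
      have := (hF a x b y).symm.trans (hF a 0 b y)
      rw [hb] at this
      have := add_left_cancel (congrArg Prod.snd this)
      rw [add_zero, ← add_sub_assoc, ← this, add_sub_cancel_right]
    rw [ZMod.eq_zero_add_div_mul_of_add Φ' (sub_ne_zero.2 hne) hper i, zero_div, zero_mul, add_zero]
  set k := (F (0, 0)).1
  have hfst' : ∀ a x, (F (a, x)).1 = k + a := by
    intro a x
    have := ZMod.eq_zero_add_div_mul_of_add (fun a => (F (a, 0)).1) one_ne_zero (r := 1)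
      (fun b => by
        rw [← hfst (b + 1) (0 + chi0 b • S + Φ (b - b)), hF b 0 b 0]) a
    rw [hfst, this, div_one, one_mul]
  obtain ⟨q, hq⟩ : ∃ q : ZMod p → ZMod p → ZMod p, ∀ b y, (F (b, y)).2 = q b y := ⟨_, fun _ _ => rfl⟩
  have hqF : ∀ a b y, q (b + 1) (y + chi0 b • S + Φ (b - a)) =
      q b y + chi0 (k + b) • S' + Φ' (b - a) := by
    intro a b y
    rw [← hq, hF a 0 b y, hq, hfst', hfst', add_sub_add_left_eq_sub]
  -- The case `a = b`, where both `Φ` and `Φ'` contribute nothing.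
  have hdiag : ∀ b y, q (b + 1) (y + chi0 b • S) = q b y + chi0 (k + b) • S' := by
    intro b y
    simpa [hΦ0, hΦ0'] using hqF b b y
  have hqΦ : ∀ i b z, q b (z + Φ i) = q b z + Φ' i := by
    intro i b z
    have h1 := hqF (b - 1 - i) (b - 1) (z - chi0 (b - 1) • S)
    have h2 := hdiag (b - 1) (z - chi0 (b - 1) • S)
    rw [← h2] at h1
    simpa using h1
  obtain ⟨i₀, hi₀⟩ : ∃ i, Φ i ≠ 0 := by
    by_contra! h
    exact hΦ ⟨0, h⟩
  have haff := fun b => ZMod.eq_zero_add_div_mul_of_add (q b) hi₀ (hqΦ i₀ b)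
  have hΦΦ' : ∀ i, Φ' i = Φ' i₀ / Φ i₀ * Φ i := by
    intro i
    have := hqΦ i 0 0
    rw [zero_add, haff] at this
    exact (add_left_cancel this).symm
  have hα : Φ' i₀ / Φ i₀ ≠ 0 := by
    intro h
    exact hΦ' ⟨0, fun i => by rw [hΦΦ', h, zero_mul]⟩
  refine ⟨Units.mk0 _ hα, ?_, hΦΦ'⟩
  -- Around the cycle of fibres the values `q b 0` cancel, and `α * S = S'` remains.
  have hsum : ∑ b, (q (b + 1) 0 + Φ' i₀ / Φ i₀ * (chi0 b • S)) =
      ∑ b, (q b 0 + chi0 (k + b) • S') :=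
    Finset.sum_congr rfl fun b _ => by rw [← haff, ← hdiag, zero_add]
  have hchi : ∑ b : ZMod p, chi0 (k + b) = 1 := by
    rw [Fintype.sum_equiv (Equiv.addLeft k) (fun b => chi0 (k + b)) chi0 fun _ => rfl]
    simp [chi0]
  have hchi' : ∑ b : ZMod p, chi0 b • S = S := by
    rw [← Finset.sum_smul]
    simp [chi0]
  have hshift : ∑ b : ZMod p, q (b + 1) 0 = ∑ b, q b 0 :=
    Fintype.sum_equiv (Equiv.addRight 1) _ _ fun _ => rfl
  rw [Finset.sum_add_distrib, Finset.sum_add_distrib, hshift, ← Finset.mul_sum, hchi',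
    ← Finset.sum_smul, hchi, one_smul] at hsum
  exact (add_left_cancel hsum).symm

theorem isomorphic_family_mul {n : ℕ} [NeZero n] (α : (ZMod n)ˣ) (S : ZMod n) (Φ : ZMod n → ZMod n) :
    (family n S Φ).Isomorphic (family n (α * S) fun i => α * Φ i) := by
  refine ⟨Equiv.prodCongr (Equiv.refl (ZMod n)) (Units.mulLeft α), ?_⟩
  rintro ⟨a, x⟩ ⟨b, y⟩
  refine Prod.ext rfl ?_
  change (α : ZMod n) * (y + chi0 b • S + Φ (b - a)) =
    α * y + chi0 b • ((α : ZMod n) * S) + α * Φ (b - a)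
  rw [mul_add, mul_add, mul_smul_comm]

end CycleSet

theorem mainTheorem6 (p : ℕ) [Fact p.Prime] :
    (∀ X : CycleSet.{u}, Nat.card X = p ^ 2 → X.Indecomposable → X.Retractable →
      X.HasFiniteMultipermutationLevel ∧
      (X.Isomorphic (CycleSet.cyclic (p ^ 2)) ∨
        ∃ (S : ZMod p) (Φ : ZMod p → ZMod p), (¬ ∃ c, ∀ i, Φ i = c) ∧ Φ 0 = 0 ∧
          X.Isomorphic (CycleSet.family p S Φ))) ∧
    (∀ (S S' : ZMod p) (Φ Φ' : ZMod p → ZMod p),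
      (¬ ∃ c, ∀ i, Φ i = c) → Φ 0 = 0 → (¬ ∃ c, ∀ i, Φ' i = c) → Φ' 0 = 0 →
      ((CycleSet.family p S Φ).Isomorphic (CycleSet.family p S' Φ') ↔
        ∃ α : (ZMod p)ˣ, S' = α * S ∧ ∀ i, Φ' i = α * Φ i)) := by
  refine ⟨fun X hp hX hret => hX.isTransitive.classification hp hret,
    fun S S' Φ Φ' hΦ h0 hΦ' h0' => ⟨fun h => h.exists_unit hΦ h0 hΦ' h0', ?_⟩⟩
  rintro ⟨α, rfl, hα⟩
  rw [funext hα]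
  exact CycleSet.isomorphic_family_mul α S Φ
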